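/- Let $A\in\mathbb{R}^{n\times n}$ and $B\in\mathbb{R}^{n\times 1}$ be such that $(A,B)$ is controllable and $A$ is unstable, i.e. at least one eigenvalue of $A$ has absolute value larger than $1$. Let $\lambda_0,\dots,\lambda_{n-1}\in\mathbb{C}$ be the eigenvalues of $A$, repeated according to algebraic multiplicity. Let $(\theta_{2,k})_{k\ge 0}$ be an i.i.d. process with values in $\{0,1\}$ on a probability space, with loss probability $\alpha_2=\mathrm{Prob}\{\theta_{2,k}=0\}\in[0,1]$. For a gain $F\in\mathbb{R}^{1\times n}$ consider the closed-loop system \[ x_{k+1}=Ax_k+Bu_k,\qquad u_k=\theta_{2,k}Fx_k,\qquad k\ge 0, \] and call it stochastically stable if $\mathbb{E}\bigl[\sum_{k=0}^{\infty}|x_k|^2\bigr]<\infty$ for every initial condition $x_0\in\mathbb{R}^n$, where $|\cdot|$ is the Euclidean norm. Then there exists a gain $F\in\mathbb{R}^{1\times n}$ such that the closed-loop system is stochastically stable if and only if \[ \alpha_2<\frac{1}{\prod_{|\lambda_i|>1}|\lambda_i|^2}. \] -/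

import Mathlib

open MeasureTheory ProbabilityTheory
open scoped Matrix

noncomputable section

namespace LossyControl

/-- The eigenvalues `λ_0, …, λ_{n-1}` of a real square matrix: the complex roots of its
characteristic polynomial, listed with algebraic multiplicity. -/
def eigenvalues {n : ℕ} (A : Matrix (Fin n) (Fin n) ℝ) : Multiset ℂ :=
  (A.map (algebraMap ℝ ℂ)).charpoly.roots

/-- `A` is unstable: at least one eigenvalue has absolute value larger than `1`. -/
def IsUnstable {n : ℕ} (A : Matrix (Fin n) (Fin n) ℝ) : Prop :=
  ∃ z ∈ eigenvalues A, 1 < ‖z‖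

/-- The product of `|λ_i| ^ 2` over the eigenvalues with `|λ_i| > 1`, with multiplicity. -/
def unstableProd {n : ℕ} (A : Matrix (Fin n) (Fin n) ℝ) : ℝ :=
  (((eigenvalues A).filter fun z => 1 < ‖z‖).map fun z => ‖z‖ ^ 2).prod

/-- The controllability matrix `[B, A B, …, A ^ (n - 1) B]`. The column with index `(j, l)` is
column `l` of `A ^ j B`. -/
def controllabilityMatrix {n m : ℕ} (A : Matrix (Fin n) (Fin n) ℝ)
    (B : Matrix (Fin n) (Fin m) ℝ) : Matrix (Fin n) (Fin n × Fin m) ℝ :=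
  Matrix.of fun i j => (A ^ (j.1 : ℕ) * B) i j.2

/-- The pair `(A, B)` is controllable: the controllability matrix has full rank. -/
def IsControllable {n m : ℕ} (A : Matrix (Fin n) (Fin n) ℝ)
    (B : Matrix (Fin n) (Fin m) ℝ) : Prop :=
  (controllabilityMatrix A B).rank = n

/-- `θ` is an i.i.d. Bernoulli process with values in `{0, 1}`, where `θ k = 0` means that the
message at time `k` is lost, and `α` is the loss probability. -/
structure IsLossProcess {Ω : Type*} [MeasurableSpace Ω] (μ : Measure Ω) (α : ℝ)
    (θ : ℕ → Ω → ℝ) : Prop where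
  measurable : ∀ k, Measurable (θ k)
  zero_or_one : ∀ k ω, θ k ω = 0 ∨ θ k ω = 1
  indep : iIndepFun θ μ
  loss_prob : ∀ k, μ.real {ω | θ k ω = 0} = α

/-- The state of the closed loop of the plant `x_{k+1} = A x_k + B u_k` with the state feedback
`u_k = θ_k F x_k` received over the lossy channel, started at `x₀`. -/
def closedLoopState {n m : ℕ} {Ω : Type*} (A : Matrix (Fin n) (Fin n) ℝ)
    (B : Matrix (Fin n) (Fin m) ℝ) (F : Matrix (Fin m) (Fin n) ℝ) (θ : ℕ → Ω → ℝ)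
    (x₀ : Fin n → ℝ) : ℕ → Ω → (Fin n → ℝ)
  | 0 => fun _ => x₀
  | k + 1 => fun ω =>
      A *ᵥ closedLoopState A B F θ x₀ k ω +
        B *ᵥ (θ k ω • (F *ᵥ closedLoopState A B F θ x₀ k ω))

/-- Stochastic stability of the closed loop: for every initial condition, the expectation of
`∑ k, |x_k| ^ 2` is finite, where `|·|` is the Euclidean norm. -/
def StochasticallyStable {n m : ℕ} {Ω : Type*} [MeasurableSpace Ω] (μ : Measure Ω)
    (A : Matrix (Fin n) (Fin n) ℝ) (B : Matrix (Fin n) (Fin m) ℝ)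
    (F : Matrix (Fin m) (Fin n) ℝ) (θ : ℕ → Ω → ℝ) : Prop :=
  ∀ x₀ : Fin n → ℝ,
    ∫⁻ ω, ∑' k, ‖WithLp.toLp 2 (closedLoopState A B F θ x₀ k ω)‖ₑ ^ 2 ∂μ < ⊤

end LossyControl

end

/-
Averaging over the channel turns quadratic costs into quadratic costs: `E |x_k|²` is the form
`Φ ^ k 1` at `x₀`, where `Φ P = α Aᵀ P A + (1 - α) (A + b f)ᵀ P (A + b f)`. Stochastic stability
therefore means that `P - Φ P` is positive definite for some positive definite `P`.

Minimising over the gain at each state bounds `Φ P` below by `Aᵀ R A` whatever `f` is, with `R` a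
rank-one downdate of `P`. Restricting a form to the unstable invariant subspace, where `A` acts as
`A₁`, and taking determinants gives `det P > det (A₁ᵀ R A₁) ≥ α (det A₁)² det P`, because the
downdate shrinks the determinant by at most the factor `α`. This is the necessity of the bound.

Conversely, if all eigenvalues of `A` lie outside the closed unit disc, the solution `W` of
`A W Aᵀ = W + b bᵀ` is positive definite and satisfies `1 + bᵀ W⁻¹ b = (det A)²`, so `P = W⁻¹` makes
the bound an equality exactly at `α = (det A)⁻²`. Replacing `A` by `t A` with `t` slightly larger
than `1` gives strictness and admits eigenvalues on the circle. In general only the unstable block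
is fed back, and the stable block is attached by a block-diagonal `P` weighting the unstable block
heavily.
-/

open Filter Topology

namespace LossyControl

section PositiveDefinite

variable {ι : Type*}

theorem exists_smul_sub_posDef [Finite ι] {D M : Matrix ι ι ℝ} (hD : D.PosDef)
    (hM : M.IsHermitian) : ∃ c > (0 : ℝ), (c • D - M).PosDef := by
  cases nonempty_fintype ι
  have hcont (Q : Matrix ι ι ℝ) : Continuous fun x : ι → ℝ => x ⬝ᵥ Q *ᵥ x := by fun_prop
  have hDpos {x : ι → ℝ} (hx : x ≠ 0) : 0 < x ⬝ᵥ D *ᵥ x := hD.dotProduct_mulVec_pos hx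
  obtain ⟨C, hC⟩ := (isCompact_sphere (0 : ι → ℝ) 1).exists_bound_of_continuousOn
    (f := fun u => (u ⬝ᵥ M *ᵥ u) / (u ⬝ᵥ D *ᵥ u))
    ((hcont M).continuousOn.div (hcont D).continuousOn fun u hu =>
      (hDpos (ne_zero_of_mem_unit_sphere ⟨u, hu⟩)).ne')
  refine ⟨|C| + 1, by positivity, .of_dotProduct_mulVec_pos
    ((hD.isHermitian.smul (star_trivial _)).sub hM) fun x hx => ?_⟩
  have hbound : x ⬝ᵥ M *ᵥ x ≤ |C| * (x ⬝ᵥ D *ᵥ x) := by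
    rw [← div_le_iff₀ (hDpos hx)]
    have hu : ‖x‖⁻¹ • x ∈ Metric.sphere (0 : ι → ℝ) 1 := by
      simp [norm_smul, (norm_pos_iff.2 hx).ne']
    have hratio := (le_abs_self _).trans ((hC _ hu).trans (le_abs_self C))
    simp only [Matrix.mulVec_smul, smul_dotProduct, dotProduct_smul, smul_eq_mul] at hratio
    rwa [mul_div_mul_left _ _ (by simpa using hx), mul_div_mul_left _ _ (by simpa using hx)]
      at hratio
  simp only [star_trivial, Matrix.sub_mulVec, Matrix.smul_mulVec, dotProduct_sub, dotProduct_smul,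
    smul_eq_mul]
  linarith [hDpos hx]

variable [Fintype ι] [DecidableEq ι]

theorem posDef_one_sub_iff_eigenvalues_lt_one {K : Matrix ι ι ℝ} (hK : K.IsHermitian) :
    (1 - K).PosDef ↔ ∀ i, hK.eigenvalues i < 1 := by
  have hdiag : 1 - K = Unitary.conjStarAlgAut ℝ _ hK.eigenvectorUnitary
      (Matrix.diagonal fun i => 1 - hK.eigenvalues i) := by
    conv_lhs => rw [hK.spectral_theorem, ← map_one (Unitary.conjStarAlgAut ℝ _ _), ← map_sub]
    rw [← Matrix.diagonal_one, Matrix.diagonal_sub]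
    rfl
  rw [hdiag, Unitary.conjStarAlgAut_apply,
    Matrix.IsUnit.posDef_star_right_conjugate_iff Unitary.isUnit_coe, Matrix.posDef_diagonal_iff]
  simp only [sub_pos]

theorem posDef_one_sub_of_trace_lt_one {K : Matrix ι ι ℝ} (hK : K.PosSemidef)
    (htr : K.trace < 1) : (1 - K).PosDef := by
  rw [posDef_one_sub_iff_eigenvalues_lt_one hK.isHermitian]
  intro i
  calc hK.isHermitian.eigenvalues i
      ≤ ∑ j, hK.isHermitian.eigenvalues j :=
        Finset.single_le_sum (fun j _ => hK.eigenvalues_nonneg j) (Finset.mem_univ i)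
    _ = K.trace := hK.isHermitian.trace_eq_sum_eigenvalues.symm
    _ < 1 := htr

theorem det_lt_one_of_posDef_one_sub [Nonempty ι] {K : Matrix ι ι ℝ} (hK : K.PosSemidef)
    (h : (1 - K).PosDef) : K.det < 1 := by
  have hlt := (posDef_one_sub_iff_eigenvalues_lt_one hK.isHermitian).1 h
  obtain ⟨i⟩ := ‹Nonempty ι›
  rw [hK.isHermitian.det_eq_prod_eigenvalues, ← Finset.mul_prod_erase _ _ (Finset.mem_univ i)]
  exact mul_lt_one_of_nonneg_of_lt_one_left (hK.eigenvalues_nonneg i) (hlt i)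
    (Finset.prod_le_one (fun j _ => hK.eigenvalues_nonneg j) fun j _ => (hlt j).le)

open scoped MatrixOrder in
theorem det_lt_det_of_posDef_sub [Nonempty ι] {P T : Matrix ι ι ℝ} (hT : T.PosSemidef)
    (h : (P - T).PosDef) : T.det < P.det := by
  have hP : P.PosDef := by simpa using h.add_posSemidef hT
  obtain ⟨R, hR, hPR⟩ :=
    CStarAlgebra.isStrictlyPositive_iff_eq_star_mul_self.1 hP.isStrictlyPositive
  have hRR : R * R⁻¹ = 1 := Matrix.mul_nonsing_inv R ((Matrix.isUnit_iff_isUnit_det R).1 hR)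
  obtain ⟨K, hTK⟩ : ∃ K, T = star R * K * R := by
    refine ⟨star R⁻¹ * T * R⁻¹, ?_⟩
    rw [← mul_assoc, ← mul_assoc, ← star_mul, mul_assoc _ R⁻¹]
    simp [mul_eq_one_comm.1 hRR]
  have hK : K.PosSemidef := (Matrix.IsUnit.posSemidef_star_left_conjugate_iff hR).1 (hTK ▸ hT)
  have hlt : K.det < 1 := by
    refine det_lt_one_of_posDef_one_sub hK
      ((Matrix.IsUnit.posDef_star_left_conjugate_iff hR).1 ?_)
    rwa [mul_sub, sub_mul, mul_one, ← hPR, ← hTK]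
  have hdet : T.det = P.det * K.det := by
    rw [hTK, hPR, Matrix.det_mul, Matrix.det_mul, Matrix.det_mul]
    ring
  rw [hdet]
  exact mul_lt_of_lt_one_right hP.det_pos hlt

end PositiveDefinite

section PositiveMap

variable {ι : Type*} {Φ : Module.End ℝ (Matrix ι ι ℝ)}

theorem posSemidef_pow_apply (hΦ : ∀ P, P.PosSemidef → (Φ P).PosSemidef) {P : Matrix ι ι ℝ}
    (hP : P.PosSemidef) (k : ℕ) : ((Φ ^ k) P).PosSemidef := by
  induction k with
  | zero => simpa using hP
  | succ k ih => simpa [pow_succ'] using hΦ _ ih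

theorem sum_pow_apply_sub (Φ : Module.End ℝ (Matrix ι ι ℝ)) (P : Matrix ι ι ℝ) (N : ℕ) :
    ∑ k ∈ Finset.range N, (Φ ^ k) (P - Φ P) = P - (Φ ^ N) P := by
  simpa using LinearMap.congr_fun (geom_sum_mul_neg Φ N) P

theorem isClosed_posSemidef [Finite ι] : IsClosed {P : Matrix ι ι ℝ | P.PosSemidef} := by
  cases nonempty_fintype ι
  have hset : {P : Matrix ι ι ℝ | P.PosSemidef} =
      {P | Pᴴ = P} ∩ ⋂ x : ι → ℝ, {P | 0 ≤ star x ⬝ᵥ P *ᵥ x} := by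
    ext P
    simp [Matrix.posSemidef_iff_dotProduct_mulVec, Matrix.IsHermitian]
  rw [hset]
  exact (isClosed_eq (by fun_prop) continuous_id).inter
    (isClosed_iInter fun x => isClosed_le continuous_const (by fun_prop))

theorem exists_posSemidef_sub_apply_eq [Finite ι]
    (hΦ : ∀ P, P.PosSemidef → (Φ P).PosSemidef)
    (hlim : ∀ P, Tendsto (fun k => (Φ ^ k) P) atTop (𝓝 0)) {Q : Matrix ι ι ℝ}
    (hQ : Q.PosSemidef) : ∃ W : Matrix ι ι ℝ, W.PosSemidef ∧ W - Φ W = Q := by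
  have hinj : Function.Injective ⇑(1 - Φ : Module.End ℝ (Matrix ι ι ℝ)) := by
    rw [injective_iff_map_eq_zero]
    intro X hX
    have hX' : X - Φ X = 0 := hX
    have hfix (k : ℕ) : (Φ ^ k) X = X := by
      rw [eq_comm, ← sub_eq_zero, ← sum_pow_apply_sub, hX']
      simp only [map_zero, Finset.sum_const_zero]
    simpa [hfix, tendsto_const_nhds_iff] using hlim X
  obtain ⟨W, hW⟩ := LinearMap.injective_iff_surjective.1 hinj Q
  have hWQ : W - Φ W = Q := hW
  have hsum : Tendsto (fun N => ∑ k ∈ Finset.range N, (Φ ^ k) Q) atTop (𝓝 W) := by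
    simpa only [← hWQ, sum_pow_apply_sub, sub_zero] using (hlim W).const_sub W
  have hsum_psd (N : ℕ) : (∑ k ∈ Finset.range N, (Φ ^ k) Q).PosSemidef :=
    Matrix.posSemidef_sum _ fun k _ => posSemidef_pow_apply hΦ hQ k
  exact ⟨W, isClosed_posSemidef.mem_of_tendsto hsum (.of_forall hsum_psd), hWQ⟩

variable [Fintype ι] [DecidableEq ι]

theorem exists_posDef_sub_apply_posDef (hΦ : ∀ P, P.PosSemidef → (Φ P).PosSemidef)
    (h : ∀ x, Tendsto (fun k => x ⬝ᵥ (Φ ^ k) 1 *ᵥ x) atTop (𝓝 0)) :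
    ∃ P, P.PosDef ∧ (P - Φ P).PosDef := by
  have htrace : Tendsto (fun k => ((Φ ^ k) 1).trace) atTop (𝓝 0) := by
    simpa [Matrix.trace] using
      tendsto_finsetSum Finset.univ fun i _ => h (Pi.single i 1)
  obtain ⟨N, hN⟩ := (htrace.eventually_lt_const one_pos).exists
  have hpow (k : ℕ) : ((Φ ^ k) 1).PosSemidef := posSemidef_pow_apply hΦ .one k
  set P := ∑ k ∈ Finset.range N, (Φ ^ k) 1 with hP
  have hPpsd : P.PosSemidef := Matrix.posSemidef_sum _ fun k _ => hpow k
  have hD : (P - Φ P).PosDef := by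
    have hsub : P - Φ P = 1 - (Φ ^ N) 1 := by
      simpa [hP, sum_apply] using LinearMap.congr_fun (mul_neg_geom_sum Φ N) 1
    exact hsub ▸ posDef_one_sub_of_trace_lt_one (hpow N) hN
  exact ⟨P, by simpa using hD.add_posSemidef (hΦ P hPpsd), hD⟩

theorem summable_of_posDef_sub_apply (hΦ : ∀ P, P.PosSemidef → (Φ P).PosSemidef)
    {P : Matrix ι ι ℝ} (hP : P.PosSemidef) (hD : (P - Φ P).PosDef) (x : ι → ℝ) :
    Summable fun k => x ⬝ᵥ (Φ ^ k) 1 *ᵥ x := by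
  obtain ⟨c, hc, hcD⟩ := exists_smul_sub_posDef hD Matrix.isHermitian_one
  have hnonneg {Q : Matrix ι ι ℝ} (hQ : Q.PosSemidef) : 0 ≤ x ⬝ᵥ Q *ᵥ x :=
    hQ.dotProduct_mulVec_nonneg x
  refine summable_of_sum_range_le (c := c * (x ⬝ᵥ P *ᵥ x))
    (fun k => hnonneg (posSemidef_pow_apply hΦ .one k)) fun N => ?_
  have hterm (k : ℕ) : x ⬝ᵥ (Φ ^ k) 1 *ᵥ x ≤ c * (x ⬝ᵥ (Φ ^ k) (P - Φ P) *ᵥ x) := by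
    have := hnonneg (posSemidef_pow_apply hΦ hcD.posSemidef k)
    simpa [-map_sub, map_sub _ (c • _), Matrix.sub_mulVec, Matrix.smul_mulVec] using this
  calc ∑ k ∈ Finset.range N, x ⬝ᵥ (Φ ^ k) 1 *ᵥ x
      ≤ ∑ k ∈ Finset.range N, c * (x ⬝ᵥ (Φ ^ k) (P - Φ P) *ᵥ x) :=
        Finset.sum_le_sum fun k _ => hterm k
    _ = c * (x ⬝ᵥ (P - (Φ ^ N) P) *ᵥ x) := by
        rw [← sum_pow_apply_sub, ← Finset.mul_sum, Matrix.sum_mulVec, dotProduct_sum]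
    _ ≤ c * (x ⬝ᵥ P *ᵥ x) := by
        rw [Matrix.sub_mulVec, dotProduct_sub]
        exact mul_le_mul_of_nonneg_left
          (sub_le_self _ (hnonneg (posSemidef_pow_apply hΦ hP N))) hc.le

end PositiveMap

section MeanOperator

variable {ι κ : Type*} [Fintype ι]

/-- The congruence `P ↦ Aᵀ P A`, which pulls a quadratic form back along `A`. -/
@[simps]
def congruence (A : Matrix ι κ ℝ) : Matrix ι ι ℝ →ₗ[ℝ] Matrix κ κ ℝ where
  toFun P := Aᵀ * P * A
  map_add' P Q := by rw [Matrix.mul_add, Matrix.add_mul]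
  map_smul' c P := by simp

theorem posSemidef_congruence [Finite κ] (A : Matrix ι κ ℝ) {P : Matrix ι ι ℝ} (hP : P.PosSemidef) :
    (congruence A P).PosSemidef := by
  simpa using hP.conjTranspose_mul_mul_same A

theorem congruence_pow [DecidableEq ι] (A : Matrix ι ι ℝ) (k : ℕ) :
    congruence A ^ k = congruence (A ^ k) := by
  induction k with
  | zero => ext1; simp
  | succ k ih =>
    ext1 P
    rw [pow_succ', Module.End.mul_apply, ih, congruence_apply, congruence_apply, congruence_apply,
      pow_succ, Matrix.transpose_mul]
    simp only [mul_assoc]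

theorem dotProduct_congruence_mulVec [Fintype κ] (A : Matrix ι κ ℝ) (P : Matrix ι ι ℝ)
    (x : κ → ℝ) : x ⬝ᵥ congruence A P *ᵥ x = (A *ᵥ x) ⬝ᵥ P *ᵥ (A *ᵥ x) := by
  rw [congruence_apply, ← Matrix.mulVec_mulVec, ← Matrix.mulVec_mulVec,
    Matrix.dotProduct_mulVec x Aᵀ, Matrix.vecMul_transpose]

/-- The operator `P ↦ α Aᵀ P A + (1 - α) Gᵀ P G`. It propagates quadratic costs backwards along
the random dynamics that apply `A` with probability `α` and `G` otherwise. -/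
def meanOp (α : ℝ) (A G : Matrix ι ι ℝ) : Module.End ℝ (Matrix ι ι ℝ) :=
  α • congruence A + (1 - α) • congruence G

theorem meanOp_apply (α : ℝ) (A G P : Matrix ι ι ℝ) :
    meanOp α A G P = α • (Aᵀ * P * A) + (1 - α) • (Gᵀ * P * G) := rfl

theorem meanOp_smul (α t : ℝ) (A G : Matrix ι ι ℝ) :
    meanOp α (t • A) (t • G) = t ^ 2 • meanOp α A G := by
  ext1 P
  simp only [meanOp_apply, LinearMap.smul_apply, Matrix.transpose_smul, Matrix.smul_mul,
    Matrix.mul_smul]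
  module

theorem dotProduct_meanOp_mulVec (α : ℝ) (A G P : Matrix ι ι ℝ) (x : ι → ℝ) :
    x ⬝ᵥ meanOp α A G P *ᵥ x =
      α * ((A *ᵥ x) ⬝ᵥ P *ᵥ (A *ᵥ x)) + (1 - α) * ((G *ᵥ x) ⬝ᵥ P *ᵥ (G *ᵥ x)) := by
  simp only [← dotProduct_congruence_mulVec, meanOp, LinearMap.add_apply, LinearMap.smul_apply,
    Matrix.add_mulVec, Matrix.smul_mulVec, dotProduct_add, dotProduct_smul, smul_eq_mul]

theorem posSemidef_meanOp {α : ℝ} (h0 : 0 ≤ α) (h1 : α ≤ 1) (A G : Matrix ι ι ℝ)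
    {P : Matrix ι ι ℝ} (hP : P.PosSemidef) : (meanOp α A G P).PosSemidef :=
  ((posSemidef_congruence A hP).smul h0).add ((posSemidef_congruence G hP).smul (sub_nonneg.2 h1))

end MeanOperator

section ClosedLoop

variable {Ω : Type*} {mΩ : MeasurableSpace Ω} {μ : Measure Ω} {α : ℝ} {θ : ℕ → Ω → ℝ}

theorem IsLossProcess.nonneg (hθ : IsLossProcess μ α θ) : 0 ≤ α :=
  hθ.loss_prob 0 ▸ measureReal_nonneg

theorem IsLossProcess.le_one [IsProbabilityMeasure μ] (hθ : IsLossProcess μ α θ) : α ≤ 1 :=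
  hθ.loss_prob 0 ▸ measureReal_le_one

theorem IsLossProcess.measure_loss [IsFiniteMeasure μ] (hθ : IsLossProcess μ α θ) (k : ℕ) :
    μ (θ k ⁻¹' {0}) = ENNReal.ofReal α := by
  rw [← hθ.loss_prob k, ofReal_measureReal]
  rfl

theorem IsLossProcess.measure_arrival [IsProbabilityMeasure μ] (hθ : IsLossProcess μ α θ) (k : ℕ) :
    μ (θ k ⁻¹' {0})ᶜ = ENNReal.ofReal (1 - α) := by
  rw [prob_compl_eq_one_sub (hθ.measurable k (measurableSet_singleton 0)), hθ.measure_loss k,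
    ENNReal.ofReal_sub _ hθ.nonneg, ENNReal.ofReal_one]

variable {n m : ℕ} (A : Matrix (Fin n) (Fin n) ℝ) (B : Matrix (Fin n) (Fin m) ℝ)
  (F : Matrix (Fin m) (Fin n) ℝ) (x₀ : Fin n → ℝ)

theorem closedLoopState_succ_of_zero {k : ℕ} {ω : Ω} (h : θ k ω = 0) :
    closedLoopState A B F θ x₀ (k + 1) ω = A *ᵥ closedLoopState A B F θ x₀ k ω := by
  simp [closedLoopState, h]

theorem closedLoopState_succ_of_one {k : ℕ} {ω : Ω} (h : θ k ω = 1) :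
    closedLoopState A B F θ x₀ (k + 1) ω = (A + B * F) *ᵥ closedLoopState A B F θ x₀ k ω := by
  simp [closedLoopState, h, Matrix.add_mulVec]

/-- The `σ`-algebra of the channel up to, but not including, time `k`. -/
abbrev channelPast (θ : ℕ → Ω → ℝ) (k : ℕ) : MeasurableSpace Ω :=
  ⨆ i ∈ Set.Iio k, MeasurableSpace.comap (θ i) inferInstance

theorem channelPast_le (hθ : ∀ k, Measurable (θ k)) (k : ℕ) : channelPast θ k ≤ mΩ :=
  iSup₂_le fun i _ => (hθ i).comap_le

theorem indep_channelPast (hθ : IsLossProcess μ α θ) (k : ℕ) :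
    Indep (MeasurableSpace.comap (θ k) inferInstance) (channelPast θ k) μ := by
  simpa only [iSup_singleton] using indep_iSup_of_disjoint
    (fun i => (hθ.measurable i).comap_le) hθ.indep (S := {k}) (T := Set.Iio k) (by simp)

theorem measurable_closedLoopState (k : ℕ) :
    Measurable[channelPast θ k] (closedLoopState A B F θ x₀ k) := by
  induction k with
  | zero => exact measurable_const
  | succ k ih =>
    have hstate : Measurable[channelPast θ (k + 1)] (closedLoopState A B F θ x₀ k) :=
      ih.mono (biSup_mono fun i hi => lt_trans hi (Nat.lt_succ_self k)) le_rfl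
    have hchannel : Measurable[channelPast θ (k + 1)] (θ k) :=
      (comap_measurable (θ k)).mono (le_biSup (fun i => MeasurableSpace.comap (θ i) inferInstance)
        (Set.mem_Iio.2 (Nat.lt_succ_self k))) le_rfl
    have hstep : Measurable fun p : (Fin n → ℝ) × ℝ => A *ᵥ p.1 + B *ᵥ (p.2 • (F *ᵥ p.1)) :=
      Continuous.measurable (by fun_prop)
    exact hstep.comp (hstate.prodMk hchannel)

theorem setLIntegral_comp_closedLoopState (hθ : IsLossProcess μ α θ) (k : ℕ) {s : Set Ω}
    (hs : MeasurableSet[MeasurableSpace.comap (θ k) inferInstance] s) {f : (Fin n → ℝ) → ENNReal}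
    (hf : Measurable f) :
    ∫⁻ ω in s, f (closedLoopState A B F θ x₀ k ω) ∂μ =
      μ s * ∫⁻ ω, f (closedLoopState A B F θ x₀ k ω) ∂μ := by
  have hs' : MeasurableSet s := (hθ.measurable k).comap_le s hs
  have hprod := lintegral_mul_eq_lintegral_mul_lintegral_of_independent_measurableSpace
    (f := s.indicator fun _ => 1) (hθ.measurable k).comap_le (channelPast_le hθ.measurable k)
    (indep_channelPast hθ k) (measurable_const.indicator hs)
    (hf.comp (measurable_closedLoopState A B F x₀ k))
  have hmul (g : Ω → ENNReal) : (fun ω => s.indicator (fun _ => 1) ω * g ω) = s.indicator g := by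
    ext ω
    simp [← Set.indicator_mul_left]
  rw [← lintegral_indicator hs', ← lintegral_indicator_one hs', ← hmul]
  exact hprod

theorem lintegral_comp_closedLoopState_succ [IsProbabilityMeasure μ] (hθ : IsLossProcess μ α θ)
    (k : ℕ) {f : (Fin n → ℝ) → ENNReal} (hf : Measurable f) :
    ∫⁻ ω, f (closedLoopState A B F θ x₀ (k + 1) ω) ∂μ =
      ENNReal.ofReal α * ∫⁻ ω, f (A *ᵥ closedLoopState A B F θ x₀ k ω) ∂μ +
        ENNReal.ofReal (1 - α) * ∫⁻ ω, f ((A + B * F) *ᵥ closedLoopState A B F θ x₀ k ω) ∂μ := by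
  have hloss : MeasurableSet[MeasurableSpace.comap (θ k) inferInstance] (θ k ⁻¹' {0}) :=
    ⟨{0}, measurableSet_singleton 0, rfl⟩
  have hloss' : MeasurableSet (θ k ⁻¹' {0}) := (hθ.measurable k).comap_le _ hloss
  have hmul (G : Matrix (Fin n) (Fin n) ℝ) : Measurable fun x => f (G *ᵥ x) :=
    hf.comp (Continuous.measurable (by fun_prop))
  rw [← lintegral_add_compl _ hloss', ← hθ.measure_loss k, ← hθ.measure_arrival k,
    ← setLIntegral_comp_closedLoopState A B F x₀ hθ k hloss (hmul A),
    ← setLIntegral_comp_closedLoopState A B F x₀ hθ k hloss.compl (hmul (A + B * F))]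
  congr 1
  · refine setLIntegral_congr_fun hloss' fun ω hω => ?_
    rw [closedLoopState_succ_of_zero A B F x₀ hω]
  · refine setLIntegral_congr_fun hloss'.compl fun ω hω => ?_
    rw [closedLoopState_succ_of_one A B F x₀ ((hθ.zero_or_one k ω).resolve_left hω)]

variable [IsProbabilityMeasure μ] (hθ : IsLossProcess μ α θ)

theorem measurable_ofReal_dotProduct_mulVec (P : Matrix (Fin n) (Fin n) ℝ) :
    Measurable fun x : Fin n → ℝ => ENNReal.ofReal (x ⬝ᵥ P *ᵥ x) :=
  ENNReal.measurable_ofReal.comp (Continuous.measurable (by fun_prop))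

include hθ

theorem lintegral_quadraticForm_closedLoopState {P : Matrix (Fin n) (Fin n) ℝ} (hP : P.PosSemidef)
    (k : ℕ) :
    ∫⁻ ω, ENNReal.ofReal (closedLoopState A B F θ x₀ k ω ⬝ᵥ
        P *ᵥ closedLoopState A B F θ x₀ k ω) ∂μ =
      ENNReal.ofReal (x₀ ⬝ᵥ (meanOp α A (A + B * F) ^ k) P *ᵥ x₀) := by
  induction k generalizing P with
  | zero => simp [closedLoopState]
  | succ k ih =>
    have hstate : Measurable (closedLoopState A B F θ x₀ k) :=
      (measurable_closedLoopState A B F x₀ k).mono (channelPast_le hθ.measurable k) le_rfl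
    have hcost (G : Matrix (Fin n) (Fin n) ℝ) : Measurable fun ω => ENNReal.ofReal
        ((G *ᵥ closedLoopState A B F θ x₀ k ω) ⬝ᵥ P *ᵥ (G *ᵥ closedLoopState A B F θ x₀ k ω)) :=
      (measurable_ofReal_dotProduct_mulVec P).comp
        ((Continuous.measurable (f := fun x => G *ᵥ x) (by fun_prop)).comp hstate)
    have hnonneg (y : Fin n → ℝ) : 0 ≤ y ⬝ᵥ P *ᵥ y := hP.dotProduct_mulVec_nonneg y
    rw [lintegral_comp_closedLoopState_succ A B F x₀ hθ k (measurable_ofReal_dotProduct_mulVec P),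
      pow_succ, Module.End.mul_apply, ← ih (posSemidef_meanOp hθ.nonneg hθ.le_one A _ hP),
      ← lintegral_const_mul _ (hcost A), ← lintegral_const_mul _ (hcost (A + B * F)),
      ← lintegral_add_left ((hcost A).const_mul _)]
    refine lintegral_congr fun ω => ?_
    have hα : 0 ≤ 1 - α := sub_nonneg.2 hθ.le_one
    rw [dotProduct_meanOp_mulVec, ENNReal.ofReal_add (mul_nonneg hθ.nonneg (hnonneg _))
      (mul_nonneg hα (hnonneg _)), ENNReal.ofReal_mul hθ.nonneg, ENNReal.ofReal_mul hα]

theorem stochasticallyStable_iff_summable :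
    StochasticallyStable μ A B F θ ↔
      ∀ x, Summable fun k => x ⬝ᵥ (meanOp α A (A + B * F) ^ k) 1 *ᵥ x := by
  have hnorm (x : Fin n → ℝ) : ‖WithLp.toLp 2 x‖ₑ ^ 2 = ENNReal.ofReal (x ⬝ᵥ 1 *ᵥ x) := by
    rw [← ofReal_norm, ← ENNReal.ofReal_pow (norm_nonneg _), EuclideanSpace.real_norm_sq_eq]
    simp [dotProduct, sq]
  refine forall_congr' fun x => ?_
  simp only [hnorm]
  have hmeas (k : ℕ) : AEMeasurable (fun ω => ENNReal.ofReal
      (closedLoopState A B F θ x k ω ⬝ᵥ 1 *ᵥ closedLoopState A B F θ x k ω)) μ :=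
    ((measurable_ofReal_dotProduct_mulVec 1).comp ((measurable_closedLoopState A B F x k).mono
      (channelPast_le hθ.measurable k) le_rfl)).aemeasurable
  rw [lintegral_tsum hmeas]
  simp only [lintegral_quadraticForm_closedLoopState A B F x hθ .one]
  refine ⟨fun h => (ENNReal.summable_toReal h.ne).congr fun k => ?_, Summable.tsum_ofReal_lt_top⟩
  exact ENNReal.toReal_ofReal ((posSemidef_pow_apply
    (fun P => posSemidef_meanOp hθ.nonneg hθ.le_one _ _) .one k).dotProduct_mulVec_nonneg x)

theorem stochasticallyStable_iff_exists_posDef :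
    StochasticallyStable μ A B F θ ↔
      ∃ P : Matrix (Fin n) (Fin n) ℝ, P.PosDef ∧ (P - meanOp α A (A + B * F) P).PosDef := by
  have hΦ (P : Matrix (Fin n) (Fin n) ℝ) :=
    posSemidef_meanOp hθ.nonneg hθ.le_one A (A + B * F) (P := P)
  rw [stochasticallyStable_iff_summable A B F hθ]
  constructor
  · exact fun h => exists_posDef_sub_apply_posDef hΦ fun x => (h x).tendsto_atTop_zero
  · rintro ⟨P, hP, hD⟩
    exact summable_of_posDef_sub_apply hΦ hP.posSemidef hD

end ClosedLoop

section SchurStable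

theorem tendsto_pow_zero_of_forall_spectrum_norm_lt_one {R : Type*} [NormedRing R]
    [NormedAlgebra ℂ R] [CompleteSpace R] {a : R} (ha : ∀ z ∈ spectrum ℂ a, ‖z‖ < 1) :
    Tendsto (fun k => a ^ k) atTop (𝓝 0) := by
  nontriviality R
  have hradius : spectralRadius ℂ a < (1 : NNReal) :=
    spectrum.spectralRadius_lt_of_forall_lt a fun z hz => by
      simpa [← NNReal.coe_lt_coe] using ha z hz
  obtain ⟨ρ, haρ, hρ⟩ := ENNReal.lt_iff_exists_nnreal_btwn.1 hradius
  refine squeeze_zero_norm' ?_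
    (tendsto_pow_atTop_nhds_zero_of_lt_one ρ.2 (show (ρ : ℝ) < 1 by exact_mod_cast hρ))
  have hGelfand := spectrum.pow_nnnorm_pow_one_div_tendsto_nhds_spectralRadius a
  filter_upwards [hGelfand.eventually_lt_const haρ, eventually_gt_atTop 0] with k hk hk0
  have hroot : ((‖a ^ k‖₊ : ENNReal) ^ (1 / k : ℝ)) ^ k < (ρ : ENNReal) ^ k :=
    ENNReal.pow_lt_pow_left hk0.ne' hk
  rw [← ENNReal.rpow_natCast, ← ENNReal.rpow_mul, one_div_mul_cancel (by positivity),
    ENNReal.rpow_one] at hroot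
  exact_mod_cast hroot.le

variable {ι : Type*} [Fintype ι] [DecidableEq ι]

/-- The complex spectrum of a real matrix: its set of eigenvalues, without multiplicity. -/
def complexSpectrum (A : Matrix ι ι ℝ) : Set ℂ := spectrum ℂ (A.map (algebraMap ℝ ℂ))

theorem mem_complexSpectrum_iff {A : Matrix ι ι ℝ} {z : ℂ} :
    z ∈ complexSpectrum A ↔ z ∈ A.charpoly.aroots ℂ := by
  rw [complexSpectrum, Matrix.mem_spectrum_iff_isRoot_charpoly, Matrix.charpoly_map,
    Polynomial.aroots, Polynomial.mem_roots ((A.charpoly_monic.map _).ne_zero)]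

theorem complexSpectrum_transpose (A : Matrix ι ι ℝ) :
    complexSpectrum Aᵀ = complexSpectrum A := by
  ext z
  rw [mem_complexSpectrum_iff, mem_complexSpectrum_iff, Matrix.charpoly_transpose]

attribute [local instance] Matrix.linftyOpNormedRing Matrix.linftyOpNormedAlgebra in
theorem tendsto_pow_zero {A : Matrix ι ι ℝ} (hA : ∀ z ∈ complexSpectrum A, ‖z‖ < 1) :
    Tendsto (fun k => A ^ k) atTop (𝓝 0) := by
  have hre : Continuous fun M : Matrix ι ι ℂ => M.map Complex.re :=
    continuous_id.matrix_map Complex.continuous_re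
  have hlim := (hre.tendsto 0).comp (tendsto_pow_zero_of_forall_spectrum_norm_lt_one hA)
  have hmap (k : ℕ) : (A.map (algebraMap ℝ ℂ) ^ k).map Complex.re = A ^ k := by
    rw [← Matrix.map_pow]
    ext i j
    simp
  simpa only [Function.comp_def, hmap, Matrix.map_zero _ Complex.zero_re] using hlim

theorem tendsto_congruence_pow_zero {A : Matrix ι ι ℝ} (hA : ∀ z ∈ complexSpectrum A, ‖z‖ < 1)
    (P : Matrix ι ι ℝ) : Tendsto (fun k => (congruence A ^ k) P) atTop (𝓝 0) := by
  have hpow := tendsto_pow_zero hA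
  have hcont : Continuous fun M : Matrix ι ι ℝ => Mᵀ * P * M := by fun_prop
  simpa [Function.comp_def, congruence_pow] using (hcont.tendsto 0).comp hpow

theorem exists_posDef_sub_congruence_posDef {A : Matrix ι ι ℝ}
    (hA : ∀ z ∈ complexSpectrum A, ‖z‖ < 1) :
    ∃ P : Matrix ι ι ℝ, P.PosDef ∧ (P - Aᵀ * P * A).PosDef := by
  refine exists_posDef_sub_apply_posDef (fun P => posSemidef_congruence A) fun x => ?_
  have hcont : Continuous fun M : Matrix ι ι ℝ => x ⬝ᵥ M *ᵥ x := by fun_prop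
  simpa [Function.comp_def] using (hcont.tendsto 0).comp (tendsto_congruence_pow_zero hA 1)

end SchurStable

section SpectralSplit

open Polynomial

theorem exists_mul_eq_of_isConjRoot {K L : Type*} [Field K] [Field L] [Algebra K L] {S : Set L}
    (hS : ∀ z w, IsConjRoot K z w → w ∈ S → z ∈ S) {p : K[X]} (hp : p ≠ 0) :
    ∃ q r : K[X], p = q * r ∧ (∀ z : L, aeval z q = 0 → z ∈ S) ∧
      ∀ z : L, aeval z r = 0 → z ∉ S := by
  induction p using WfDvdMonoid.induction_on_irreducible with
  | zero => exact absurd rfl hp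
  | unit u hu =>
    exact ⟨u, 1, (mul_one u).symm, fun z hz => absurd hz (hu.map (aeval z)).ne_zero,
      fun z hz => by simp at hz⟩
  | mul a i ha hi ih =>
    obtain ⟨q, r, rfl, hq, hr⟩ := ih ha
    have hconj : ∀ z w : L, aeval z i = 0 → aeval w i = 0 → w ∈ S → z ∈ S := fun z w hz hw =>
      hS z w <| by
        rw [IsConjRoot, ← minpoly.eq_of_irreducible hi hz, ← minpoly.eq_of_irreducible hi hw]
    by_cases h : ∃ w : L, aeval w i = 0 ∧ w ∈ S
    · obtain ⟨w, hw, hwS⟩ := h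
      refine ⟨i * q, r, (mul_assoc i q r).symm, fun z hz => ?_, hr⟩
      rw [map_mul, mul_eq_zero] at hz
      exact hz.elim (fun hz => hconj z w hz hw hwS) (hq z)
    · push Not at h
      refine ⟨q, i * r, mul_left_comm i q r, hq, fun z hz => ?_⟩
      rw [map_mul, mul_eq_zero] at hz
      exact hz.elim (h z) (hr z)

theorem norm_eq_of_isConjRoot {z w : ℂ} (h : IsConjRoot ℝ z w) : ‖z‖ = ‖w‖ := by
  have : IsAlgClosure ℝ ℂ := ⟨inferInstance, inferInstance⟩
  have : Normal ℝ ℂ := IsAlgClosure.normal ℝ ℂ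
  obtain ⟨σ, rfl⟩ := isConjRoot_iff_exists_algEquiv.1 h
  rcases Complex.real_algHom_eq_id_or_conj (σ : ℂ →ₐ[ℝ] ℂ) with hσ | hσ
  · exact congrArg norm (DFunLike.congr_fun hσ w)
  · exact (congrArg norm (DFunLike.congr_fun hσ w)).trans (Complex.norm_conj w)

section Field

variable {K V : Type*} [Field K] [AddCommGroup V] [Module K V]

theorem mapsTo_ker_aeval (f : Module.End K V) (p : K[X]) :
    ∀ x ∈ LinearMap.ker (aeval f p), f x ∈ LinearMap.ker (aeval f p) := by
  intro x hx
  have hcomm : Commute (aeval f p) f := by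
    simpa using (Commute.all p (X : K[X])).map (aeval f)
  rw [LinearMap.mem_ker] at hx ⊢
  rw [← Module.End.mul_apply, hcomm.eq, Module.End.mul_apply, hx, map_zero]

theorem coe_aeval_restrict_apply {f : Module.End K V} {U : Submodule K V}
    (hU : ∀ x ∈ U, f x ∈ U) (p : K[X]) (x : U) :
    (aeval (f.restrict hU) p x : V) = aeval f p x := by
  induction p using Polynomial.induction_on' with
  | add p q hp hq => simp [hp, hq]
  | monomial k c =>
    simp only [aeval_monomial, Module.End.mul_apply, Module.algebraMap_end_apply,
      Submodule.coe_smul, Module.End.pow_restrict k hU, LinearMap.coe_restrict_apply]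

theorem aeval_restrict_ker_aeval (f : Module.End K V) (p : K[X]) :
    aeval (f.restrict (mapsTo_ker_aeval f p)) p = 0 := by
  ext x
  rw [coe_aeval_restrict_apply]
  exact x.2

theorem aeval_toMatrix {ι : Type*} [Fintype ι] [DecidableEq ι] (b : Module.Basis ι K V)
    (f : Module.End K V) (p : K[X]) :
    aeval (LinearMap.toMatrix b b f) p = LinearMap.toMatrix b b (aeval f p) :=
  aeval_algHom_apply (LinearMap.toMatrixAlgEquiv b).toAlgHom f p

theorem exists_basis_toMatrix_eq_fromBlocks [FiniteDimensional K V] (f : Module.End K V)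
    {p q : K[X]} (hpq : IsCoprime p q) (hf : aeval f (p * q) = 0) :
    ∃ (r s : ℕ) (b : Module.Basis (Fin r ⊕ Fin s) K V) (A₁ : Matrix (Fin r) (Fin r) K)
      (A₂ : Matrix (Fin s) (Fin s) K),
      LinearMap.toMatrix b b f = Matrix.fromBlocks A₁ 0 0 A₂ ∧ aeval A₁ p = 0 ∧ aeval A₂ q = 0 := by
  set U := LinearMap.ker (aeval f p)
  set W := LinearMap.ker (aeval f q)
  have hUW : IsCompl U W := by
    refine ⟨disjoint_ker_aeval_of_isCoprime f hpq, codisjoint_iff.2 ?_⟩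
    rw [sup_ker_aeval_eq_ker_aeval_mul_of_coprime f hpq, hf, LinearMap.ker_zero]
  let fU := f.restrict (mapsTo_ker_aeval f p)
  let fW := f.restrict (mapsTo_ker_aeval f q)
  let bU := Module.finBasis K U
  let bW := Module.finBasis K W
  let e := Submodule.prodEquivOfIsCompl U W hUW
  have hconj (x : U × W) : f (e x) = e (fU.prodMap fW x) := by simp [e, fU, fW]
  refine ⟨_, _, (bU.prod bW).map e, LinearMap.toMatrix bU bU fU, LinearMap.toMatrix bW bW fW,
    ?_, ?_, ?_⟩
  · rw [← LinearMap.toMatrix_prodMap]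
    ext i j
    simp only [LinearMap.toMatrix_apply, Module.Basis.map_apply, Module.Basis.map_repr,
      LinearEquiv.trans_apply, hconj, LinearEquiv.symm_apply_apply]
  · rw [aeval_toMatrix, aeval_restrict_ker_aeval, map_zero]
  · rw [aeval_toMatrix, aeval_restrict_ker_aeval, map_zero]

end Field

section Real

variable {ι : Type*} [Fintype ι] [DecidableEq ι]

theorem nonempty_of_mem_complexSpectrum {A : Matrix ι ι ℝ} {z : ℂ} (hz : z ∈ complexSpectrum A) :
    Nonempty ι := by
  by_contra h
  rw [not_nonempty_iff] at h
  simp [mem_complexSpectrum_iff] at hz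

theorem aeval_eq_zero_of_mem_complexSpectrum {A : Matrix ι ι ℝ} {p : ℝ[X]} (hp : aeval A p = 0)
    {z : ℂ} (hz : z ∈ complexSpectrum A) : aeval z p = 0 := by
  have := nonempty_of_mem_complexSpectrum hz
  have hpA : aeval (A.map (algebraMap ℝ ℂ)) (p.map (algebraMap ℝ ℂ)) = 0 := by
    rw [aeval_map_algebraMap]
    exact (aeval_algHom_apply (Algebra.ofId ℝ ℂ).mapMatrix A p).trans (by rw [hp, map_zero])
  have hmem := spectrum.subset_polynomial_aeval (A.map (algebraMap ℝ ℂ))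
    (p.map (algebraMap ℝ ℂ)) ⟨z, hz, rfl⟩
  simpa only [hpA, spectrum.zero_eq, Set.mem_singleton_iff, eval_map_algebraMap] using hmem

theorem exists_spectral_split (A : Matrix ι ι ℝ) :
    ∃ (r s : ℕ) (A₁ : Matrix (Fin r) (Fin r) ℝ) (A₂ : Matrix (Fin s) (Fin s) ℝ)
      (S : Matrix ι (Fin r ⊕ Fin s) ℝ) (T : Matrix (Fin r ⊕ Fin s) ι ℝ),
      S * T = 1 ∧ T * S = 1 ∧ A = S * Matrix.fromBlocks A₁ 0 0 A₂ * T ∧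
      A.charpoly = A₁.charpoly * A₂.charpoly ∧
      (∀ z ∈ complexSpectrum A₁, 1 ≤ ‖z‖) ∧ ∀ z ∈ complexSpectrum A₂, ‖z‖ < 1 := by
  obtain ⟨p, q, hApq, hp, hq⟩ := exists_mul_eq_of_isConjRoot (S := {z : ℂ | 1 ≤ ‖z‖})
    (fun z w h (hw : 1 ≤ ‖w‖) => hw.trans_eq (norm_eq_of_isConjRoot h).symm)
    A.charpoly_monic.ne_zero
  have hpq : IsCoprime p q :=
    (isCoprime_iff_aeval_ne_zero_of_isAlgClosed (k := ℝ) ℂ p q).2 fun z => by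
      by_contra! h
      exact hq z h.2 (hp z h.1)
  have hA : aeval (Matrix.toLin' A) (p * q) = 0 := by
    rw [← hApq, ← Matrix.charpoly_toLin', LinearMap.aeval_self_charpoly]
  obtain ⟨r, s, b, A₁, A₂, hb, hA₁, hA₂⟩ :=
    exists_basis_toMatrix_eq_fromBlocks (Matrix.toLin' A) hpq hA
  let std := Pi.basisFun ℝ ι
  refine ⟨r, s, A₁, A₂, std.toMatrix b, b.toMatrix std, std.toMatrix_mul_toMatrix_flip b,
    b.toMatrix_mul_toMatrix_flip std, ?_, ?_,
    fun z hz => hp z (aeval_eq_zero_of_mem_complexSpectrum hA₁ hz),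
    fun z hz => lt_of_not_ge (hq z (aeval_eq_zero_of_mem_complexSpectrum hA₂ hz))⟩
  · rw [← hb, basis_toMatrix_mul_linearMap_toMatrix, linearMap_toMatrix_mul_basis_toMatrix]
    exact (LinearMap.toMatrix'_toLin' A).symm
  · rw [← Matrix.charpoly_fromBlocks_zero₁₂, ← hb, LinearMap.charpoly_toMatrix,
      Matrix.charpoly_toLin']

end Real

section UnstableProd

variable {n r s : ℕ} {A : Matrix (Fin n) (Fin n) ℝ}

theorem eigenvalues_eq_aroots (A : Matrix (Fin n) (Fin n) ℝ) :
    eigenvalues A = A.charpoly.aroots ℂ := by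
  rw [eigenvalues, Matrix.charpoly_map, aroots]

theorem mem_eigenvalues_iff {z : ℂ} : z ∈ eigenvalues A ↔ z ∈ complexSpectrum A := by
  rw [eigenvalues_eq_aroots, mem_complexSpectrum_iff]

theorem unstableProd_pos (A : Matrix (Fin n) (Fin n) ℝ) : 0 < unstableProd A := by
  refine Multiset.prod_pos fun x hx => ?_
  obtain ⟨z, hz, rfl⟩ := Multiset.mem_map.1 hx
  exact pow_pos (one_pos.trans (Multiset.mem_filter.1 hz).2) 2

theorem det_sq_eq_prod_eigenvalues (A : Matrix (Fin n) (Fin n) ℝ) :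
    A.det ^ 2 = ((eigenvalues A).map fun z => ‖z‖ ^ 2).prod := by
  have hdet : (A.map (algebraMap ℝ ℂ)).det = A.det := ((algebraMap ℝ ℂ).map_det A).symm
  rw [eigenvalues, Multiset.prod_map_pow, ← sq_abs, ← Real.norm_eq_abs, ← Complex.norm_real,
    ← hdet, Matrix.det_eq_prod_roots_charpoly]
  exact congrArg (· ^ 2) (map_multiset_prod (normHom : ℂ →*₀ ℝ) _)

theorem unstableProd_eq_one (hA : ∀ z ∈ complexSpectrum A, ‖z‖ < 1) : unstableProd A = 1 := by
  rw [unstableProd, Multiset.filter_eq_nil.2 fun z hz => (hA z (mem_eigenvalues_iff.1 hz)).not_gt]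
  simp

theorem unstableProd_eq_det_sq (hA : ∀ z ∈ complexSpectrum A, 1 ≤ ‖z‖) :
    unstableProd A = A.det ^ 2 := by
  rw [det_sq_eq_prod_eigenvalues, unstableProd]
  conv_rhs => rw [← Multiset.filter_add_not (fun z : ℂ => 1 < ‖z‖) (eigenvalues A),
    Multiset.map_add, Multiset.prod_add]
  refine (mul_eq_left₀ (unstableProd_pos A).ne').2 (Multiset.prod_eq_one fun x hx => ?_) |>.symm
  obtain ⟨z, hz, rfl⟩ := Multiset.mem_map.1 hx
  obtain ⟨hzA, hz1⟩ := Multiset.mem_filter.1 hz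
  rw [le_antisymm (not_lt.1 hz1) (hA z (mem_eigenvalues_iff.1 hzA)), one_pow]

theorem unstableProd_eq_mul {A₁ : Matrix (Fin r) (Fin r) ℝ} {A₂ : Matrix (Fin s) (Fin s) ℝ}
    (h : A.charpoly = A₁.charpoly * A₂.charpoly) :
    unstableProd A = unstableProd A₁ * unstableProd A₂ := by
  simp only [unstableProd, eigenvalues_eq_aroots]
  rw [h, aroots_mul (mul_ne_zero A₁.charpoly_monic.ne_zero A₂.charpoly_monic.ne_zero),
    Multiset.filter_add, Multiset.map_add, Multiset.prod_add]

theorem exists_unstable_split (hA : ∃ z ∈ complexSpectrum A, 1 ≤ ‖z‖) :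
    ∃ (r s : ℕ) (A₁ : Matrix (Fin r) (Fin r) ℝ) (A₂ : Matrix (Fin s) (Fin s) ℝ)
      (S : Matrix (Fin n) (Fin r ⊕ Fin s) ℝ) (T : Matrix (Fin r ⊕ Fin s) (Fin n) ℝ),
      Nonempty (Fin r) ∧ S * T = 1 ∧ T * S = 1 ∧ A = S * Matrix.fromBlocks A₁ 0 0 A₂ * T ∧
      unstableProd A = A₁.det ^ 2 ∧
      (∀ z ∈ complexSpectrum A₁, 1 ≤ ‖z‖) ∧ ∀ z ∈ complexSpectrum A₂, ‖z‖ < 1 := by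
  obtain ⟨r, s, A₁, A₂, S, T, hST, hTS, hAST, hchar, hA₁, hA₂⟩ := exists_spectral_split A
  refine ⟨r, s, A₁, A₂, S, T, ?_, hST, hTS, hAST, ?_, hA₁, hA₂⟩
  · obtain ⟨z, hz, hz1⟩ := hA
    rw [mem_complexSpectrum_iff, hchar,
      aroots_mul (mul_ne_zero A₁.charpoly_monic.ne_zero A₂.charpoly_monic.ne_zero),
      Multiset.mem_add, ← mem_complexSpectrum_iff, ← mem_complexSpectrum_iff] at hz
    rcases hz with hz | hz
    · exact nonempty_of_mem_complexSpectrum hz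
    · exact absurd (hA₂ z hz) hz1.not_gt
  · rw [unstableProd_eq_mul hchar, unstableProd_eq_det_sq hA₁, unstableProd_eq_one hA₂, mul_one]

end UnstableProd

end SpectralSplit

section MinCost

open Matrix (vecMulVec)

variable {ι κ : Type*} [Fintype ι] {P : Matrix ι ι ℝ}

/-- The quadratic form `x ↦ min_t (α xᵀPx + (1 - α) (x + t b)ᵀP(x + t b))`, the least expected cost
`P` when the correction `t b` is lost with probability `α`; the minimum is attained at
`t = -(bᵀPb)⁻¹ bᵀPx`. For `b = 0` it is `P`, since `0⁻¹ = 0`. -/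
noncomputable def minCost (α : ℝ) (P : Matrix ι ι ℝ) (b : ι → ℝ) : Matrix ι ι ℝ :=
  P - ((1 - α) * (b ⬝ᵥ P *ᵥ b)⁻¹) • vecMulVec (P *ᵥ b) (P *ᵥ b)

theorem transpose_mul_mul_minCost (α : ℝ) (P : Matrix ι ι ℝ) (b : ι → ℝ) (C : Matrix ι κ ℝ) :
    Cᵀ * minCost α P b * C = Cᵀ * P * C -
      ((1 - α) * (b ⬝ᵥ P *ᵥ b)⁻¹) • vecMulVec (Cᵀ *ᵥ P *ᵥ b) (Cᵀ *ᵥ P *ᵥ b) := by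
  rw [minCost, Matrix.mul_sub, Matrix.sub_mul, Matrix.mul_smul, Matrix.smul_mul,
    Matrix.mul_vecMulVec, Matrix.vecMulVec_mul, ← Matrix.mulVec_transpose]

theorem congruence_add_vecMulVec (hP : P.IsSymm) (A : Matrix ι ι ℝ) (b f : ι → ℝ) :
    (A + vecMulVec b f)ᵀ * P * (A + vecMulVec b f) =
      Aᵀ * P * A + vecMulVec (Aᵀ *ᵥ P *ᵥ b) f + vecMulVec f (Aᵀ *ᵥ P *ᵥ b) +
        (b ⬝ᵥ P *ᵥ b) • vecMulVec f f := by
  have hbP : b ᵥ* P = P *ᵥ b := by rw [← Matrix.mulVec_transpose, hP.eq]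
  rw [Matrix.transpose_add, Matrix.transpose_vecMulVec, Matrix.add_mul, Matrix.vecMulVec_mul, hbP,
    Matrix.add_mul, Matrix.mul_add, Matrix.mul_add, Matrix.mul_vecMulVec, ← Matrix.mulVec_mulVec,
    Matrix.vecMulVec_mul, ← Matrix.mulVec_transpose, Matrix.vecMulVec_mul_vecMulVec,
    dotProduct_comm b, Matrix.vecMulVec_smul]
  abel

theorem meanOp_add_vecMulVec (α : ℝ) (hP : P.IsSymm) {b : ι → ℝ} (hb : b ⬝ᵥ P *ᵥ b ≠ 0)
    (A : Matrix ι ι ℝ) (f : ι → ℝ) :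
    meanOp α A (A + vecMulVec b f) P = Aᵀ * minCost α P b * A +
      ((1 - α) * (b ⬝ᵥ P *ᵥ b)) • vecMulVec (f + (b ⬝ᵥ P *ᵥ b)⁻¹ • Aᵀ *ᵥ P *ᵥ b)
        (f + (b ⬝ᵥ P *ᵥ b)⁻¹ • Aᵀ *ᵥ P *ᵥ b) := by
  rw [meanOp_apply, congruence_add_vecMulVec hP, transpose_mul_mul_minCost]
  ext i j
  simp only [Matrix.add_apply, Matrix.sub_apply, Matrix.smul_apply, Matrix.vecMulVec_apply,
    Pi.add_apply, Pi.smul_apply, smul_eq_mul]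
  field_simp
  ring

theorem posSemidef_meanOp_sub_minCost {α : ℝ} (h1 : α ≤ 1) (hP : P.IsSymm) {b : ι → ℝ}
    (hb : 0 < b ⬝ᵥ P *ᵥ b) (A : Matrix ι ι ℝ) (f : ι → ℝ) :
    (meanOp α A (A + vecMulVec b f) P - Aᵀ * minCost α P b * A).PosSemidef := by
  rw [meanOp_add_vecMulVec α hP hb.ne', add_sub_cancel_left]
  exact (Matrix.posSemidef_vecMulVec_self_star _).smul (mul_nonneg (sub_nonneg.2 h1) hb.le)

theorem exists_meanOp_eq_minCost (α : ℝ) (hP : P.IsSymm) {b : ι → ℝ} (hb : b ⬝ᵥ P *ᵥ b ≠ 0)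
    (A : Matrix ι ι ℝ) :
    ∃ f, meanOp α A (A + vecMulVec b f) P = Aᵀ * minCost α P b * A :=
  ⟨-((b ⬝ᵥ P *ᵥ b)⁻¹ • Aᵀ *ᵥ P *ᵥ b), by
    rw [meanOp_add_vecMulVec α hP hb, neg_add_cancel, Matrix.zero_vecMulVec, smul_zero, add_zero]⟩

theorem posSemidef_minCost {α : ℝ} (h0 : 0 ≤ α) (h1 : α ≤ 1) (hP : P.PosSemidef) {b : ι → ℝ}
    (hb : b ⬝ᵥ P *ᵥ b ≠ 0) : (minCost α P b).PosSemidef := by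
  classical
  have hsymm : P.IsSymm := Matrix.isHermitian_iff_isSymm.1 hP.isHermitian
  obtain ⟨f, hf⟩ := exists_meanOp_eq_minCost α hsymm hb 1
  have hmean := posSemidef_meanOp h0 h1 1 (1 + vecMulVec b f) hP
  rwa [hf, Matrix.transpose_one, one_mul, mul_one] at hmean

theorem posSemidef_minCost_sub_minCost {α β : ℝ} (hαβ : α ≤ β) {b : ι → ℝ}
    (hb : 0 ≤ b ⬝ᵥ P *ᵥ b) : (minCost β P b - minCost α P b).PosSemidef := by
  have hsub : minCost β P b - minCost α P b =
      ((β - α) * (b ⬝ᵥ P *ᵥ b)⁻¹) • vecMulVec (P *ᵥ b) (P *ᵥ b) := by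
    rw [minCost, minCost]
    module
  rw [hsub]
  exact (Matrix.posSemidef_vecMulVec_self_star _).smul
    (mul_nonneg (sub_nonneg.2 hαβ) (inv_nonneg.2 hb))

variable [Fintype κ] [DecidableEq κ]

theorem det_sub_smul_vecMulVec {M : Matrix κ κ ℝ} (hM : IsUnit M.det) (c : ℝ) (u v : κ → ℝ) :
    (M - c • vecMulVec u v).det = M.det * (1 - c * (v ⬝ᵥ M⁻¹ *ᵥ u)) := by
  rw [sub_eq_add_neg, ← neg_smul, ← Matrix.smul_vecMulVec, Matrix.vecMulVec_eq Unit,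
    Matrix.det_add_replicateCol_mul_replicateRow hM, Matrix.mul_assoc,
    Matrix.det_unique (n := Unit)]
  simp [Matrix.mul_apply, dotProduct, Matrix.mulVec, Finset.mul_sum, mul_left_comm, sub_eq_add_neg]

-- The right-hand side is affine in `α`, equals `det (Cᵀ P C)` at `α = 1` and is nonnegative at `0`.
theorem mul_det_le_det_minCost {α : ℝ} (h1 : α ≤ 1) (hP : P.PosDef) {b : ι → ℝ}
    (hb : b ⬝ᵥ P *ᵥ b ≠ 0) {C : Matrix ι κ ℝ} (hC : Function.Injective C.mulVec) :
    α * (Cᵀ * P * C).det ≤ (Cᵀ * minCost α P b * C).det := by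
  have hunit : IsUnit (Cᵀ * P * C).det := by
    simpa using (hP.conjTranspose_mul_mul_same hC).det_pos.ne'.isUnit
  have hzero : 0 ≤ (Cᵀ * minCost 0 P b * C).det := by
    simpa using ((posSemidef_minCost le_rfl zero_le_one hP.posSemidef hb).conjTranspose_mul_mul_same
      C).det_nonneg
  simp only [transpose_mul_mul_minCost, det_sub_smul_vecMulVec hunit] at hzero ⊢
  linear_combination mul_nonneg (sub_nonneg.2 h1) hzero

theorem mul_det_sq_lt_one_of_posDef_sub_meanOp [Nonempty κ] {α : ℝ} (h0 : 0 ≤ α) (h1 : α ≤ 1)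
    (hP : P.PosDef) {A : Matrix ι ι ℝ} {b f : ι → ℝ} (hb : b ≠ 0)
    (h : (P - meanOp α A (A + vecMulVec b f) P).PosDef) {C : Matrix ι κ ℝ}
    (hC : Function.Injective C.mulVec) {A₁ : Matrix κ κ ℝ} (hAC : A * C = C * A₁) :
    α * A₁.det ^ 2 < 1 := by
  have hsymm : P.IsSymm := Matrix.isHermitian_iff_isSymm.1 hP.isHermitian
  have hbP : 0 < b ⬝ᵥ P *ᵥ b := by simpa using hP.dotProduct_mulVec_pos hb
  have hP₁ : (Cᵀ * P * C).PosDef := by simpa using hP.conjTranspose_mul_mul_same hC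
  have hR₁ : (Cᵀ * minCost α P b * C).PosSemidef := by
    simpa using (posSemidef_minCost h0 h1 hP.posSemidef hbP.ne').conjTranspose_mul_mul_same C
  have hsub : (P - Aᵀ * minCost α P b * A).PosDef := by
    simpa using h.add_posSemidef (posSemidef_meanOp_sub_minCost h1 hsymm hbP A f)
  have hsub₁ : (Cᵀ * P * C - A₁ᵀ * (Cᵀ * minCost α P b * C) * A₁).PosDef := by
    have hblock : Cᵀ * (Aᵀ * minCost α P b * A) * C = A₁ᵀ * (Cᵀ * minCost α P b * C) * A₁ := by
      calc Cᵀ * (Aᵀ * minCost α P b * A) * C = (A * C)ᵀ * minCost α P b * (A * C) := by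
            simp only [Matrix.transpose_mul, Matrix.mul_assoc]
        _ = _ := by rw [hAC]; simp only [Matrix.transpose_mul, Matrix.mul_assoc]
    simpa [Matrix.mul_sub, Matrix.sub_mul, hblock] using hsub.conjTranspose_mul_mul_same hC
  have hdet : α * A₁.det ^ 2 * (Cᵀ * P * C).det < (Cᵀ * P * C).det :=
    calc α * A₁.det ^ 2 * (Cᵀ * P * C).det = A₁.det ^ 2 * (α * (Cᵀ * P * C).det) := by ring
      _ ≤ A₁.det ^ 2 * (Cᵀ * minCost α P b * C).det :=
        mul_le_mul_of_nonneg_left (mul_det_le_det_minCost h1 hP hbP.ne' hC) (sq_nonneg _)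
      _ = (A₁ᵀ * (Cᵀ * minCost α P b * C) * A₁).det := by
        rw [Matrix.det_mul, Matrix.det_mul, Matrix.det_transpose]; ring
      _ < (Cᵀ * P * C).det :=
        det_lt_det_of_posDef_sub (by simpa using hR₁.conjTranspose_mul_mul_same A₁) hsub₁
  exact (mul_lt_iff_lt_one_left hP₁.det_pos).1 hdet

end MinCost

section Reachability

variable {ι κ : Type*} [Fintype ι] [DecidableEq ι] [Fintype κ] [DecidableEq κ] {N : ℕ}
  {A : Matrix ι ι ℝ} {b : ι → ℝ}

/-- Every state is reachable within `N` steps from the input direction `b`. This is the dual form of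
the condition that `b, A b, …, A ^ (N - 1) b` span: no nonzero covector annihilates all of them. -/
def IsReachable (N : ℕ) (A : Matrix ι ι ℝ) (b : ι → ℝ) : Prop :=
  ∀ y : ι → ℝ, (∀ k < N, y ⬝ᵥ A ^ k *ᵥ b = 0) → y = 0

theorem IsReachable.ne_zero [Nonempty ι] (h : IsReachable N A b) : b ≠ 0 := by
  rintro rfl
  exact one_ne_zero (h 1 fun k _ => by rw [Matrix.mulVec_zero, dotProduct_zero])

theorem IsReachable.smul {t : ℝ} (ht : t ≠ 0) (h : IsReachable N A b) :
    IsReachable N (t • A) b := by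
  refine fun y hy => h y fun k hk => ?_
  simpa [smul_pow, Matrix.smul_mulVec, ht] using hy k hk

theorem IsReachable.of_mul_eq_mul (h : IsReachable N A b) {A₁ : Matrix κ κ ℝ} {T : Matrix κ ι ℝ}
    {S : Matrix ι κ ℝ} (hTA : T * A = A₁ * T) (hTS : T * S = 1) : IsReachable N A₁ (T *ᵥ b) := by
  have hpow (k : ℕ) : T * A ^ k = A₁ ^ k * T := by
    induction k with
    | zero => simp
    | succ k ih =>
      rw [pow_succ, ← Matrix.mul_assoc, ih, Matrix.mul_assoc, hTA, ← Matrix.mul_assoc, ← pow_succ]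
  refine fun y hy => ?_
  have hyT : y ᵥ* T = 0 := h _ fun k hk => by
    rw [← Matrix.dotProduct_mulVec, Matrix.mulVec_mulVec, hpow, ← Matrix.mulVec_mulVec]
    exact hy k hk
  rw [← Matrix.vecMul_one y, ← hTS, ← Matrix.vecMul_vecMul, hyT, Matrix.zero_vecMul]

theorem IsReachable.of_fromBlocks {A₁ : Matrix ι ι ℝ} {A₂ : Matrix κ κ ℝ} {b : ι ⊕ κ → ℝ}
    (h : IsReachable N (Matrix.fromBlocks A₁ 0 0 A₂) b) : IsReachable N A₁ (b ∘ Sum.inl) := by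
  have hred := h.of_mul_eq_mul (A₁ := A₁) (T := Matrix.fromCols 1 0) (S := Matrix.fromRows 1 0)
    (by simp [Matrix.fromCols_mul_fromBlocks, Matrix.mul_fromCols])
    (by simp [Matrix.fromCols_mul_fromRows])
  simpa [Matrix.fromCols_mulVec] using hred

theorem isReachable_of_isControllable {n : ℕ} {A : Matrix (Fin n) (Fin n) ℝ}
    {B : Matrix (Fin n) (Fin 1) ℝ} (h : IsControllable A B) : IsReachable n A (B.col 0) := by
  intro y hy
  have hsurj : LinearMap.range (controllabilityMatrix A B).mulVecLin = ⊤ :=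
    Submodule.eq_top_of_finrank_eq (by rw [Module.finrank_fin_fun]; exact h)
  have hy0 : y ᵥ* controllabilityMatrix A B = 0 := by
    ext ⟨k, l⟩
    rw [Subsingleton.elim l 0]
    exact hy k k.2
  obtain ⟨x, hx⟩ := LinearMap.range_eq_top.1 hsurj y
  rw [Matrix.mulVecLin_apply] at hx
  refine dotProduct_self_eq_zero.1 ?_
  nth_rewrite 2 [← hx]
  rw [Matrix.dotProduct_mulVec, hy0, zero_dotProduct]

end Reachability

section Antistable

open Matrix (vecMulVec)

variable {ι : Type*} [Fintype ι] [DecidableEq ι] {N : ℕ} {A W : Matrix ι ι ℝ} {b : ι → ℝ}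

theorem isUnit_of_zero_notMem_complexSpectrum (h : 0 ∉ complexSpectrum A) : IsUnit A := by
  rw [complexSpectrum, spectrum.zero_notMem_iff, Matrix.isUnit_iff_isUnit_det] at h
  rw [Matrix.isUnit_iff_isUnit_det]
  have hdet : algebraMap ℝ ℂ A.det ≠ 0 := by
    rw [(algebraMap ℝ ℂ).map_det]
    exact h.ne_zero
  exact (ne_zero_of_map hdet).isUnit

theorem inv_mem_complexSpectrum (hA : IsUnit A) {z : ℂ} (hz : z ∈ complexSpectrum A⁻¹) :
    z⁻¹ ∈ complexSpectrum A := by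
  obtain ⟨u, rfl⟩ := hA
  rw [← Matrix.coe_units_inv] at hz
  let v := Units.map (algebraMap ℝ ℂ).mapMatrix.toMonoidHom u
  have hzv : z ∈ spectrum ℂ (↑v⁻¹ : Matrix ι ι ℂ) := hz
  rwa [← spectrum.map_inv] at hzv

theorem complexSpectrum_smul {t : ℝ} (ht : t ≠ 0) {z : ℂ} (hz : z ∈ complexSpectrum (t • A)) :
    ∃ w ∈ complexSpectrum A, z = t * w := by
  have hmap : (t • A).map (algebraMap ℝ ℂ) =
      Units.mk0 (t : ℂ) (Complex.ofReal_ne_zero.2 ht) • A.map (algebraMap ℝ ℂ) := by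
    ext i j
    simp [Units.smul_def]
  rw [complexSpectrum, hmap, spectrum.unit_smul_eq_smul] at hz
  obtain ⟨w, hw, rfl⟩ := hz
  exact ⟨w, hw, rfl⟩

theorem dotProduct_pow_mulVec_eq_zero (hW : W.PosSemidef) (hAW : A * W * Aᵀ = W + vecMulVec b b)
    {x : ι → ℝ} (hx : W *ᵥ (Aᵀ ^ N *ᵥ x) = 0) : ∀ k < N, x ⬝ᵥ A ^ k *ᵥ b = 0 := by
  have hstep {y : ι → ℝ} (hy : W *ᵥ (Aᵀ *ᵥ y) = 0) : W *ᵥ y = 0 ∧ y ⬝ᵥ b = 0 := by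
    have hsum : y ⬝ᵥ W *ᵥ y + (y ⬝ᵥ b) ^ 2 = 0 := by
      have hquad : y ⬝ᵥ (A * W * Aᵀ) *ᵥ y = 0 := by
        rw [← Matrix.mulVec_mulVec, ← Matrix.mulVec_mulVec, hy, Matrix.mulVec_zero,
          dotProduct_zero]
      rw [← hquad, hAW, Matrix.add_mulVec, dotProduct_add, Matrix.vecMulVec_mulVec,
        dotProduct_comm b y]
      simp [sq]
    have hnonneg : 0 ≤ y ⬝ᵥ W *ᵥ y := hW.dotProduct_mulVec_nonneg y
    have hyb := sq_nonneg (y ⬝ᵥ b)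
    exact ⟨(hW.dotProduct_mulVec_zero_iff y).1 (show y ⬝ᵥ W *ᵥ y = 0 by linarith),
      pow_eq_zero_iff two_ne_zero |>.1 (by linarith)⟩
  induction N with
  | zero => simp
  | succ N ih =>
    rw [pow_succ', ← Matrix.mulVec_mulVec] at hx
    obtain ⟨hxN, hxb⟩ := hstep hx
    intro k hk
    rcases Nat.lt_succ_iff_lt_or_eq.1 hk with hk | rfl
    · exact ih hxN k hk
    · rwa [Matrix.dotProduct_mulVec, ← Matrix.mulVec_transpose, Matrix.transpose_pow]

theorem exists_posDef_mul_mul_transpose_eq (hA : ∀ z ∈ complexSpectrum A, 1 < ‖z‖)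
    (hb : IsReachable N A b) : ∃ W : Matrix ι ι ℝ, W.PosDef ∧ A * W * Aᵀ = W + vecMulVec b b := by
  have hunit : IsUnit A := isUnit_of_zero_notMem_complexSpectrum fun h => by
    simpa using (zero_lt_one.trans (hA 0 h)).ne'
  have hAdet : IsUnit A.det := (Matrix.isUnit_iff_isUnit_det A).1 hunit
  have hinv : ∀ z ∈ complexSpectrum A⁻¹ᵀ, ‖z‖ < 1 := by
    intro z hz
    rw [complexSpectrum_transpose] at hz
    have hz1 := hA _ (inv_mem_complexSpectrum hunit hz)
    rw [norm_inv] at hz1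
    exact (one_lt_inv_iff₀.1 hz1).2
  obtain ⟨W, hW, hWeq⟩ := exists_posSemidef_sub_apply_eq (fun P => posSemidef_congruence A⁻¹ᵀ)
    (tendsto_congruence_pow_zero hinv)
    (posSemidef_congruence A⁻¹ᵀ (Matrix.posSemidef_vecMulVec_self_star b))
  have hAW : A * W * Aᵀ = W + vecMulVec b b := by
    have hWinv : W = A⁻¹ * (W + vecMulVec b b) * A⁻¹ᵀ := by
      rw [sub_eq_iff_eq_add'] at hWeq
      simpa [Matrix.mul_add, Matrix.add_mul] using hWeq
    nth_rewrite 1 [hWinv]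
    rw [Matrix.mul_assoc, Matrix.mul_assoc, Matrix.mul_assoc, ← Matrix.transpose_mul,
      Matrix.mul_nonsing_inv A hAdet, Matrix.transpose_one, Matrix.mul_one,
      Matrix.mul_nonsing_inv_cancel_left A _ hAdet]
  refine ⟨W, hW.posDef_iff_det_ne_zero.2 fun hdet => ?_, hAW⟩
  obtain ⟨x, hx, hWx⟩ := Matrix.exists_mulVec_eq_zero_iff.2 hdet
  have hpow : IsUnit (Aᵀ ^ N) := (Matrix.isUnit_transpose A |>.2 hunit).pow N
  obtain ⟨y, rfl⟩ := Matrix.mulVec_surjective_iff_isUnit.2 hpow x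
  rw [hb y (dotProduct_pow_mulVec_eq_zero hW hAW hWx), Matrix.mulVec_zero] at hx
  exact hx rfl

theorem one_add_dotProduct_inv_mulVec (hW : W.PosDef) (hAW : A * W * Aᵀ = W + vecMulVec b b) :
    1 + b ⬝ᵥ W⁻¹ *ᵥ b = A.det ^ 2 := by
  have hdet := congrArg Matrix.det hAW
  have hsub := det_sub_smul_vecMulVec hW.det_pos.ne'.isUnit (-1) b b
  rw [neg_one_smul, sub_neg_eq_add, ← hdet, Matrix.det_mul, Matrix.det_mul, Matrix.det_transpose]
    at hsub
  refine mul_left_cancel₀ hW.det_pos.ne' ?_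
  linear_combination -hsub

theorem transpose_mul_minCost_mul_eq (hW : W.PosDef) (hAW : A * W * Aᵀ = W + vecMulVec b b)
    (hb : b ≠ 0) : Aᵀ * minCost (A.det ^ 2)⁻¹ W⁻¹ b * A = W⁻¹ := by
  set P := W⁻¹
  have hWP : W * P = 1 := Matrix.mul_nonsing_inv W hW.det_pos.ne'.isUnit
  have hWPb : W *ᵥ P *ᵥ b = b := by rw [Matrix.mulVec_mulVec, hWP, Matrix.one_mulVec]
  have hbP : b ᵥ* P = P *ᵥ b := by
    rw [← Matrix.mulVec_transpose, (Matrix.isHermitian_iff_isSymm.1 hW.inv.isHermitian).eq]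
  have hbPb : 0 < b ⬝ᵥ P *ᵥ b := hW.inv.dotProduct_mulVec_pos hb
  have hcoeff : (1 - (1 + b ⬝ᵥ P *ᵥ b)⁻¹) * (b ⬝ᵥ P *ᵥ b)⁻¹ * (1 + b ⬝ᵥ P *ᵥ b) = 1 := by
    field_simp
    ring
  have hShermanMorrison : (W + vecMulVec b b) * minCost (A.det ^ 2)⁻¹ P b = 1 := by
    calc (W + vecMulVec b b) * minCost (A.det ^ 2)⁻¹ P b
        = 1 + (1 - (1 - (1 + b ⬝ᵥ P *ᵥ b)⁻¹) * (b ⬝ᵥ P *ᵥ b)⁻¹ * (1 + b ⬝ᵥ P *ᵥ b)) •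
            vecMulVec b (P *ᵥ b) := by
          rw [minCost, ← one_add_dotProduct_inv_mulVec hW hAW, Matrix.mul_sub, Matrix.add_mul, hWP,
            Matrix.vecMulVec_mul, hbP, Matrix.mul_smul, Matrix.add_mul, Matrix.mul_vecMulVec, hWPb,
            Matrix.vecMulVec_mul_vecMulVec, Matrix.vecMulVec_smul]
          module
      _ = 1 := by rw [hcoeff, sub_self, zero_smul, add_zero]
  have hinv : A * (W * Aᵀ * minCost (A.det ^ 2)⁻¹ P b) = 1 := by
    rw [← hShermanMorrison, ← hAW]
    simp only [Matrix.mul_assoc]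
  refine (Matrix.inv_eq_right_inv ?_).symm
  rw [← mul_eq_one_comm.1 hinv]
  simp only [Matrix.mul_assoc]

theorem exists_posDef_posSemidef_sub_meanOp [Nonempty ι] {α : ℝ}
    (hA : ∀ z ∈ complexSpectrum A, 1 < ‖z‖) (hb : IsReachable N A b) (hα : α * A.det ^ 2 ≤ 1) :
    ∃ (P : Matrix ι ι ℝ) (f : ι → ℝ),
      P.PosDef ∧ (P - meanOp α A (A + vecMulVec b f) P).PosSemidef := by
  obtain ⟨W, hW, hAW⟩ := exists_posDef_mul_mul_transpose_eq hA hb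
  have hbP : 0 < b ⬝ᵥ W⁻¹ *ᵥ b := hW.inv.dotProduct_mulVec_pos hb.ne_zero
  have hdet : 0 < A.det ^ 2 := by
    rw [← one_add_dotProduct_inv_mulVec hW hAW]
    positivity
  have hα' : α ≤ (A.det ^ 2)⁻¹ := by rwa [← one_div, le_div_iff₀ hdet]
  obtain ⟨f, hf⟩ := exists_meanOp_eq_minCost α
    (Matrix.isHermitian_iff_isSymm.1 hW.inv.isHermitian) hbP.ne' A
  refine ⟨W⁻¹, f, hW.inv, ?_⟩
  rw [hf]
  nth_rewrite 1 [← transpose_mul_minCost_mul_eq hW hAW hb.ne_zero]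
  rw [← Matrix.sub_mul, ← Matrix.mul_sub]
  exact posSemidef_congruence A (posSemidef_minCost_sub_minCost hα' hbP.le)

theorem exists_one_lt_mul_det_smul_sq_le {α : ℝ} (hα : α * A.det ^ 2 < 1) :
    ∃ t : ℝ, 1 < t ∧ α * (t • A).det ^ 2 ≤ 1 := by
  have hcont : Continuous fun t : ℝ => α * (t • A).det ^ 2 := by fun_prop
  have hlim := (hcont.tendsto 1).eventually_lt_const (show α * ((1 : ℝ) • A).det ^ 2 < 1 by simpa)
  obtain ⟨t, htα, ht⟩ := ((hlim.filter_mono nhdsWithin_le_nhds).and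
    (self_mem_nhdsWithin : Set.Ioi 1 ∈ 𝓝[>] (1 : ℝ))).exists
  exact ⟨t, ht, htα.le⟩

theorem exists_posDef_posDef_sub_meanOp [Nonempty ι] {α : ℝ}
    (hA : ∀ z ∈ complexSpectrum A, 1 ≤ ‖z‖) (hb : IsReachable N A b) (hα : α * A.det ^ 2 < 1) :
    ∃ (P : Matrix ι ι ℝ) (f : ι → ℝ),
      P.PosDef ∧ (P - meanOp α A (A + vecMulVec b f) P).PosDef := by
  obtain ⟨t, ht, hαt⟩ := exists_one_lt_mul_det_smul_sq_le hα
  have ht0 : 0 < t := one_pos.trans ht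
  have htA : ∀ z ∈ complexSpectrum (t • A), 1 < ‖z‖ := by
    intro z hz
    obtain ⟨w, hw, rfl⟩ := complexSpectrum_smul ht0.ne' hz
    rw [norm_mul, Complex.norm_of_nonneg ht0.le]
    exact one_lt_mul_of_lt_of_le ht (hA w hw)
  obtain ⟨P, f, hP, hPf⟩ := exists_posDef_posSemidef_sub_meanOp htA (hb.smul ht0.ne') hαt
  have hscale : t • A + vecMulVec b f = t • (A + vecMulVec b (t⁻¹ • f)) := by
    rw [Matrix.vecMulVec_smul, smul_add, smul_inv_smul₀ ht0.ne']
  rw [hscale, meanOp_smul] at hPf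
  refine ⟨P, t⁻¹ • f, hP, ?_⟩
  have hsplit : P - meanOp α A (A + vecMulVec b (t⁻¹ • f)) P = (1 - (t ^ 2)⁻¹) • P +
      (t ^ 2)⁻¹ • (P - (t ^ 2 • meanOp α A (A + vecMulVec b (t⁻¹ • f))) P) := by
    rw [LinearMap.smul_apply, smul_sub, inv_smul_smul₀ (pow_pos ht0 2).ne']
    module
  rw [hsplit]
  exact (hP.smul (sub_pos.2 (inv_lt_one_of_one_lt₀ (one_lt_pow₀ ht two_ne_zero)))).add_posSemidef
    (hPf.smul (by positivity))

end Antistable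

section Cascade

variable {ι κ : Type*}

theorem posDef_fromBlocks [Finite ι] [Fintype κ] [DecidableEq κ] {A : Matrix ι ι ℝ}
    {B : Matrix ι κ ℝ} {D : Matrix κ κ ℝ} (hD : D.PosDef) (h : (A - B * D⁻¹ * Bᵀ).PosDef) :
    (Matrix.fromBlocks A B Bᵀ D).PosDef := by
  classical
  cases nonempty_fintype ι
  have : Invertible D := D.invertibleOfIsUnitDet hD.det_pos.ne'.isUnit
  have hsemidef : (Matrix.fromBlocks A B Bᵀ D).PosSemidef := by
    simpa using (Matrix.PosDef.fromBlocks₂₂ A B hD).2 (by simpa using h.posSemidef)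
  refine hsemidef.posDef_iff_det_ne_zero.2 ?_
  rw [Matrix.det_fromBlocks₂₂, Matrix.invOf_eq_nonsing_inv]
  exact mul_ne_zero hD.det_pos.ne' h.det_pos.ne'

theorem exists_posDef_fromBlocks_smul_sub [Finite ι] [Finite κ] {D₁ M : Matrix ι ι ℝ}
    (hD₁ : D₁.PosDef) (hM : M.IsHermitian) (E : Matrix ι κ ℝ)
    {D₂ : Matrix κ κ ℝ} (hD₂ : D₂.PosDef) :
    ∃ c > (0 : ℝ), (Matrix.fromBlocks (c • D₁ - M) E Eᵀ D₂).PosDef := by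
  classical
  cases nonempty_fintype κ
  have hE : (E * D₂⁻¹ * Eᵀ).IsHermitian := by
    simpa using (hD₂.inv.posSemidef.mul_mul_conjTranspose_same E).isHermitian
  obtain ⟨c, hc, h⟩ := exists_smul_sub_posDef hD₁ (hM.add hE)
  exact ⟨c, hc, posDef_fromBlocks hD₂ (by rwa [sub_sub])⟩

theorem meanOp_fromBlocks [Fintype ι] [Fintype κ] (α : ℝ) (A₁ G₁ P₁ : Matrix ι ι ℝ)
    (A₂ P₂ : Matrix κ κ ℝ) (H : Matrix κ ι ℝ) :
    meanOp α (Matrix.fromBlocks A₁ 0 0 A₂) (Matrix.fromBlocks G₁ 0 H A₂)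
        (Matrix.fromBlocks P₁ 0 0 P₂) =
      Matrix.fromBlocks (meanOp α A₁ G₁ P₁ + (1 - α) • (Hᵀ * P₂ * H))
        ((1 - α) • (Hᵀ * P₂ * A₂)) ((1 - α) • (A₂ᵀ * P₂ * H)) (A₂ᵀ * P₂ * A₂) := by
  simp only [meanOp_apply, Matrix.fromBlocks_transpose, Matrix.fromBlocks_multiply,
    Matrix.fromBlocks_smul, Matrix.fromBlocks_add, Matrix.transpose_zero, Matrix.mul_zero,
    Matrix.zero_mul, add_zero, zero_add, smul_zero]
  congr 1
  all_goals module

theorem exists_posDef_sub_meanOp_fromBlocks [Fintype ι] [Fintype κ] {α : ℝ}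
    {A₁ G₁ P₁ : Matrix ι ι ℝ} {A₂ P₂ : Matrix κ κ ℝ} (H : Matrix κ ι ℝ) (hP₁ : P₁.PosDef)
    (h₁ : (P₁ - meanOp α A₁ G₁ P₁).PosDef) (hP₂ : P₂.PosDef)
    (h₂ : (P₂ - A₂ᵀ * P₂ * A₂).PosDef) :
    ∃ P : Matrix (ι ⊕ κ) (ι ⊕ κ) ℝ, P.PosDef ∧
      (P - meanOp α (Matrix.fromBlocks A₁ 0 0 A₂) (Matrix.fromBlocks G₁ 0 H A₂) P).PosDef := by
  classical
  have hH : ((1 - α) • (Hᵀ * P₂ * H)).IsHermitian := by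
    simpa using ((hP₂.posSemidef.conjTranspose_mul_mul_same H).isHermitian).smul
      (IsSelfAdjoint.all (1 - α))
  obtain ⟨c, hc, h⟩ :=
    exists_posDef_fromBlocks_smul_sub h₁ hH (-((1 - α) • (Hᵀ * P₂ * A₂))) h₂
  refine ⟨Matrix.fromBlocks (c • P₁) 0 0 P₂, ?_, ?_⟩
  · simpa using posDef_fromBlocks (B := 0) hP₂ (by simpa using hP₁.smul hc)
  have hsymm : P₂ᵀ = P₂ := Matrix.isHermitian_iff_isSymm.1 hP₂.isHermitian
  convert h using 1
  rw [meanOp_fromBlocks, map_smul, sub_eq_add_neg, Matrix.fromBlocks_neg, Matrix.fromBlocks_add,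
    zero_add, zero_add, ← sub_eq_add_neg, ← sub_eq_add_neg, sub_add_eq_sub_sub, smul_sub]
  simp [hsymm, Matrix.mul_assoc]

end Cascade

section Similarity

variable {ι κ : Type*} [Fintype ι] [Fintype κ] [DecidableEq κ]
  {S : Matrix ι κ ℝ} {T : Matrix κ ι ℝ}

theorem meanOp_similarity (hTS : T * S = 1) (α : ℝ) (A G P : Matrix κ κ ℝ) :
    meanOp α (S * A * T) (S * G * T) (Tᵀ * P * T) = Tᵀ * meanOp α A G P * T := by
  have hcongr (M : Matrix κ κ ℝ) :
      (S * M * T)ᵀ * (Tᵀ * P * T) * (S * M * T) = Tᵀ * (Mᵀ * P * M) * T := by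
    calc (S * M * T)ᵀ * (Tᵀ * P * T) * (S * M * T)
        = Tᵀ * (Mᵀ * (T * S)ᵀ * P * (T * S) * M) * T := by
          simp only [Matrix.transpose_mul, Matrix.mul_assoc]
      _ = Tᵀ * (Mᵀ * P * M) * T := by
          rw [hTS, Matrix.transpose_one, Matrix.mul_one, Matrix.mul_one]
  simp only [meanOp_apply, hcongr, Matrix.mul_add, Matrix.add_mul, Matrix.mul_smul, Matrix.smul_mul]

theorem exists_posDef_sub_meanOp_of_similarity [DecidableEq ι] (hST : S * T = 1) (hTS : T * S = 1)
    {α : ℝ} {A G : Matrix κ κ ℝ}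
    (h : ∃ P : Matrix κ κ ℝ, P.PosDef ∧ (P - meanOp α A G P).PosDef) :
    ∃ P : Matrix ι ι ℝ, P.PosDef ∧ (P - meanOp α (S * A * T) (S * G * T) P).PosDef := by
  obtain ⟨P, hP, hPG⟩ := h
  have hT : Function.Injective T.mulVec :=
    Function.LeftInverse.injective (g := S.mulVec) fun x => by
      rw [Matrix.mulVec_mulVec, hST, Matrix.one_mulVec]
  refine ⟨Tᵀ * P * T, by simpa using hP.conjTranspose_mul_mul_same hT, ?_⟩
  rw [meanOp_similarity hTS, ← Matrix.sub_mul, ← Matrix.mul_sub]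
  simpa using hPG.conjTranspose_mul_mul_same hT

end Similarity

section UnstableProdBounds

open Matrix (vecMulVec)

variable {n N : ℕ} {A : Matrix (Fin n) (Fin n) ℝ} {α : ℝ} {b : Fin n → ℝ}

theorem mul_unstableProd_lt_one (hA : ∃ z ∈ complexSpectrum A, 1 ≤ ‖z‖) (h0 : 0 ≤ α) (h1 : α ≤ 1)
    (hb : b ≠ 0) {f : Fin n → ℝ} {P : Matrix (Fin n) (Fin n) ℝ} (hP : P.PosDef)
    (h : (P - meanOp α A (A + vecMulVec b f) P).PosDef) : α * unstableProd A < 1 := by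
  obtain ⟨r, s, A₁, A₂, S, T, _, -, hTS, rfl, hprod, -⟩ := exists_unstable_split hA
  let E : Matrix (Fin r ⊕ Fin s) (Fin r) ℝ := Matrix.fromRows 1 0
  have hE : Eᵀ * T * (S * E) = 1 := by
    rw [Matrix.mul_assoc, ← Matrix.mul_assoc T, hTS, Matrix.one_mul]
    simp [E, Matrix.transpose_fromRows, Matrix.fromCols_mul_fromRows]
  have hC : Function.Injective (S * E).mulVec :=
    Function.LeftInverse.injective (g := (Eᵀ * T).mulVec) fun y => by
      rw [Matrix.mulVec_mulVec, hE, Matrix.one_mulVec]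
  rw [hprod]
  refine mul_det_sq_lt_one_of_posDef_sub_meanOp h0 h1 hP hb h hC (A₁ := A₁) ?_
  rw [Matrix.mul_assoc _ T, ← Matrix.mul_assoc T, hTS, Matrix.one_mul, Matrix.mul_assoc,
    Matrix.mul_assoc]
  simp [E, Matrix.fromBlocks_mul_fromRows, Matrix.fromRows_mul]

theorem exists_posDef_sub_meanOp_of_mul_unstableProd_lt_one
    (hA : ∃ z ∈ complexSpectrum A, 1 ≤ ‖z‖) (hb : IsReachable N A b)
    (hα : α * unstableProd A < 1) :
    ∃ f, ∃ P : Matrix (Fin n) (Fin n) ℝ, P.PosDef ∧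
      (P - meanOp α A (A + vecMulVec b f) P).PosDef := by
  obtain ⟨r, s, A₁, A₂, S, T, _, hST, hTS, rfl, hprod, hA₁, hA₂⟩ := exists_unstable_split hA
  set A' := Matrix.fromBlocks A₁ 0 0 A₂
  have hb' : IsReachable N A' (T *ᵥ b) := hb.of_mul_eq_mul
    (by rw [← Matrix.mul_assoc, ← Matrix.mul_assoc, hTS, Matrix.one_mul]) hTS
  obtain ⟨P₁, f₁, hP₁, h₁⟩ :=
    exists_posDef_posDef_sub_meanOp hA₁ hb'.of_fromBlocks (hprod ▸ hα)
  obtain ⟨P₂, hP₂, h₂⟩ := exists_posDef_sub_congruence_posDef hA₂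
  let f' : Fin r ⊕ Fin s → ℝ := Sum.elim f₁ 0
  have hblocks : A' + vecMulVec (T *ᵥ b) f' = Matrix.fromBlocks
      (A₁ + vecMulVec ((T *ᵥ b) ∘ Sum.inl) f₁) 0 (vecMulVec ((T *ᵥ b) ∘ Sum.inr) f₁) A₂ := by
    ext (i | i) (j | j) <;> simp [A', f', Matrix.vecMulVec_apply]
  have hgain : S * (A' + vecMulVec (T *ᵥ b) f') * T = S * A' * T + vecMulVec b (f' ᵥ* T) := by
    rw [Matrix.mul_add, Matrix.add_mul, Matrix.mul_vecMulVec, Matrix.vecMulVec_mul,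
      Matrix.mulVec_mulVec, hST, Matrix.one_mulVec]
  refine ⟨f' ᵥ* T, hgain ▸ exists_posDef_sub_meanOp_of_similarity hST hTS ?_⟩
  rw [hblocks]
  exact exists_posDef_sub_meanOp_fromBlocks _ hP₁ h₁ hP₂ h₂

end UnstableProdBounds

theorem proposition1_general {n : ℕ} (A : Matrix (Fin n) (Fin n) ℝ) (B : Matrix (Fin n) (Fin 1) ℝ)
    (hAB : IsControllable A B) (hA : ∃ z ∈ eigenvalues A, 1 ≤ ‖z‖) {Ω : Type*} [MeasurableSpace Ω]
    (μ : Measure Ω) [IsProbabilityMeasure μ] (α : ℝ) (θ : ℕ → Ω → ℝ)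
    (hθ : IsLossProcess μ α θ) :
    (∃ F : Matrix (Fin 1) (Fin n) ℝ, StochasticallyStable μ A B F θ) ↔
      α < 1 / unstableProd A := by
  simp only [mem_eigenvalues_iff] at hA
  have hmul (F : Matrix (Fin 1) (Fin n) ℝ) : B * F = Matrix.vecMulVec (B.col 0) (F.row 0) := by
    ext i j
    simp [Matrix.mul_apply, Matrix.vecMulVec_apply]
  have hb := isReachable_of_isControllable hAB
  simp only [stochasticallyStable_iff_exists_posDef A B _ hθ, hmul,
    lt_div_iff₀ (unstableProd_pos A)]
  constructor
  · rintro ⟨F, P, hP, h⟩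
    have := nonempty_of_mem_complexSpectrum hA.choose_spec.1
    exact mul_unstableProd_lt_one hA hθ.nonneg hθ.le_one hb.ne_zero hP h
  · intro hα
    obtain ⟨f, h⟩ := exists_posDef_sub_meanOp_of_mul_unstableProd_lt_one hA hb hα
    exact ⟨Matrix.of fun _ => f, h⟩

end LossyControl

theorem proposition1 {n : ℕ} (A : Matrix (Fin n) (Fin n) ℝ) (B : Matrix (Fin n) (Fin 1) ℝ)
    (hAB : LossyControl.IsControllable A B) (hA : LossyControl.IsUnstable A)
    {Ω : Type*} [MeasurableSpace Ω] (μ : Measure Ω) [IsProbabilityMeasure μ]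
    (α₂ : ℝ) (θ₂ : ℕ → Ω → ℝ) (hθ : LossyControl.IsLossProcess μ α₂ θ₂) :
    (∃ F : Matrix (Fin 1) (Fin n) ℝ, LossyControl.StochasticallyStable μ A B F θ₂) ↔
      α₂ < 1 / LossyControl.unstableProd A :=
  LossyControl.proposition1_general A B hAB (hA.imp fun _ h => ⟨h.1, h.2.le⟩) μ α₂ θ₂ hθ
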